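/- Let $k$ be an infinite field, let $n, s$ and $d_1,\dots,d_s$ be non-negative integers, and let $x = (x_1,\dots,x_n)$. Introduce an indeterminate $t_{i,e}$ for each $1 \le i \le s$ and each exponent $e \in \mathbb{Z}_{\ge 0}^n$ with $|e| = d_i$; let $t$ be the set of all of them and $N$ their number. Let $I' \subset k[t,x]$ be the ideal generated by the generic forms $$F_i = \sum_{|e| = d_i} t_{i,e}\, x^e \qquad (1 \le i \le s).$$ For a point $a \in \mathbb{A}_k^N = k^N$ let $I_a \subset k[x]$ be the ideal generated by $F_1(a,x),\dots,F_s(a,x)$. Let $\preceq$ and $\preceq_t$ be monomial orders on the monomials in $x$ and in $t$ respectively, and let $\preceq'$ be the corresponding inverse block order on the monomials in $t$ and $x$: for monomials $u_1,u_2$ in $t$ and $v_1,v_2$ in $x$, $u_1v_1 \preceq' u_2v_2$ if and only if $v_1 \prec v_2$, or $v_1 = v_2$ and $u_1 \preceq_t u_2$. For a nonzero $g \in k[t,x]$ let $\mathrm{LM}_{\preceq}(g)$ be the leading monomial with respect to $\preceq$ of $g$ regarded as a polynomial in $x$ with coefficients in $k[t]$. Let $U \subset \mathbb{A}_k^N$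 be the set of points $a$ such that $\dim_k (k[x]/I_a)_e \le \dim_k (k[x]/I_b)_e$ for all $b \in \mathbb{A}_k^N$ and all $e \ge 0$. Call $V \subset \mathbb{A}_k^N$ a set of $V$-generic points (for $\preceq$) if $V$ is Zariski open and dense in $\mathbb{A}_k^N$, $V \subset U$, and the initial ideal $\mathrm{in}_{\preceq}(I_a)$ is the same for all $a \in V$. Let $\mathcal{G}$ be a (finite) Gröbner basis of $I'$ with respect to $\preceq'$. Then a set of $V$-generic points exists, and for every such set $V$ and every $a \in V$, $$\mathrm{in}_{\preceq}(I_a) = \bigl(\mathrm{LM}_{\preceq}(g) \mid g \in \mathcal{G},\ g \ne 0\bigr) \subset k[x].$$ That is, the monomial ideal generated by the leading monomials in $x$ of the elements of $\mathcal{G}$ is the initial ideal of $V$-generic ideals with respect to the restricted order $\preceq$. -/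

import Mathlib

open MvPolynomial

noncomputable section

namespace GenericForms

/-! ### Initial ideals and Gröbner bases over a field -/

/-- The initial ideal of `I`, generated by the leading terms of all elements of `I`. -/
def initialIdeal {σ k : Type*} [Field k] (m : MonomialOrder σ) (I : Ideal (MvPolynomial σ k)) :
    Ideal (MvPolynomial σ k) :=
  Ideal.span {p | ∃ f ∈ I, p = m.leadingTerm f}

/-- A finite set `G ⊆ I` is a Gröbner basis of `I` if its leading terms generate the initial ideal
of `I`.  (The leading term of `0` is `0`, so it is harmless whether `0` belongs to `G`.) -/
def IsGroebnerBasis {σ k : Type*} [Field k] (m : MonomialOrder σ)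
    (G : Finset (MvPolynomial σ k)) (I : Ideal (MvPolynomial σ k)) : Prop :=
  (∀ g ∈ G, g ∈ I) ∧ initialIdeal m I = Ideal.span {p | ∃ g ∈ G, p = m.leadingTerm g}

/-! ### Inverse block orders -/

/-- `m'` is the inverse block order on monomials in the variables `x` (indexed by `σ`) and `t`
(indexed by `τ`) made of `mx` and `mt`: the `x`-parts are compared first, by `mx`, and ties are
broken by comparing the `t`-parts by `mt`.  The monomial `x ^ v * t ^ u` is
`Finsupp.sumElim v u`. -/
def IsInverseBlock {σ τ : Type*} (mx : MonomialOrder σ) (mt : MonomialOrder τ)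
    (m' : MonomialOrder (σ ⊕ τ)) : Prop :=
  ∀ (v₁ v₂ : σ →₀ ℕ) (u₁ u₂ : τ →₀ ℕ),
    m'.toSyn (Finsupp.sumElim v₁ u₁) ≤ m'.toSyn (Finsupp.sumElim v₂ u₂) ↔
      mx.toSyn v₁ < mx.toSyn v₂ ∨ (v₁ = v₂ ∧ mt.toSyn u₁ ≤ mt.toSyn u₂)

/-- The exponent of the leading monomial, with respect to `mx`, of `g ∈ k[t, x]` viewed as an
element of `k[t][x]`. -/
def xLeadingExponent {σ τ k : Type*} [Field k] (mx : MonomialOrder σ)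
    (g : MvPolynomial (σ ⊕ τ) k) : σ →₀ ℕ :=
  mx.degree (sumAlgEquiv k σ τ g)

/-- The monomial ideal of `k[x]` generated by the `x`-leading monomials of the (nonzero) elements
of `G`. -/
def xLeadingIdeal {σ τ k : Type*} [Field k] (mx : MonomialOrder σ)
    (G : Finset (MvPolynomial (σ ⊕ τ) k)) : Ideal (MvPolynomial σ k) :=
  Ideal.span {p | ∃ g ∈ G, g ≠ 0 ∧ p = monomial (xLeadingExponent mx g) (1 : k)}

/-! ### Generic forms and their specializations -/

/-- The parameters `t`: one for each `i` and each monomial of degree `d i` in `x₁, …, xₙ`. -/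
abbrev Param (n : ℕ) {s : ℕ} (d : Fin s → ℕ) : Type :=
  Σ i : Fin s, {e : Fin n →₀ ℕ // e ∈ Finset.finsuppAntidiag Finset.univ (d i)}

/-- The generic form `F i = ∑ t_{i,e} x ^ e ∈ k[t, x]`, the sum being over all monomials `x ^ e`
of degree `d i`. -/
def genericForm (k : Type*) [Field k] (n : ℕ) {s : ℕ} (d : Fin s → ℕ) (i : Fin s) :
    MvPolynomial (Fin n ⊕ Param n d) k :=
  ∑ e : {e : Fin n →₀ ℕ // e ∈ Finset.finsuppAntidiag Finset.univ (d i)},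
    X (Sum.inr ⟨i, e⟩) * ∏ j : Fin n, X (Sum.inl j) ^ (e : Fin n →₀ ℕ) j

/-- The ideal of `k[t, x]` generated by the generic forms. -/
def genericIdeal (k : Type*) [Field k] (n : ℕ) {s : ℕ} (d : Fin s → ℕ) :
    Ideal (MvPolynomial (Fin n ⊕ Param n d) k) :=
  Ideal.span (Set.range (genericForm k n d))

/-- The specialization `F(t, x) ↦ F(a, x)`. -/
def specialize {σ τ k : Type*} [Field k] (a : τ → k) :
    MvPolynomial (σ ⊕ τ) k →ₐ[k] MvPolynomial σ k :=
  aeval (Sum.elim X (fun j => C (a j)))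

/-- The ideal of `k[x]` corresponding to the point `a`, generated by the specializations at `a` of
the generic forms. -/
def idealAt {k : Type*} [Field k] {n s : ℕ} (d : Fin s → ℕ) (a : Param n d → k) :
    Ideal (MvPolynomial (Fin n) k) :=
  Ideal.span (Set.range fun i => specialize a (genericForm k n d i))

/-- The Hilbert function of `k[x] / I`: the dimension of the degree `e` part, that is, of the image
in `k[x] / I` of the forms of degree `e`. -/
def hilbertFunction {k : Type*} [Field k] {n : ℕ} (I : Ideal (MvPolynomial (Fin n) k)) (e : ℕ) :
    ℕ :=
  Module.finrank k
    ((homogeneousSubmodule (Fin n) k e).map (Ideal.Quotient.mkₐ k I).toLinearMap)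

/-! ### Zariski topology on the affine space of points and generic ideals -/

/-- Zariski open subsets of the affine space `k ^ τ`. -/
def IsZariskiOpen {τ k : Type*} [Field k] (V : Set (τ → k)) : Prop :=
  ∃ P : Ideal (MvPolynomial τ k), V = (zeroLocus k P)ᶜ

/-- Zariski dense subsets of the affine space `k ^ τ`. -/
def IsZariskiDense {τ k : Type*} [Field k] (V : Set (τ → k)) : Prop :=
  ∀ W : Set (τ → k), IsZariskiOpen W → W.Nonempty → (V ∩ W).Nonempty

/-- The set `U` of points whose ideal has, in every degree, the largest possible dimension, that
is, the smallest possible Hilbert function of the quotient. -/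
def uGenericSet (k : Type*) [Field k] (n : ℕ) {s : ℕ} (d : Fin s → ℕ) : Set (Param n d → k) :=
  {a | ∀ (b : Param n d → k) (e : ℕ),
    hilbertFunction (idealAt d a) e ≤ hilbertFunction (idealAt d b) e}

/-- `V` is a Zariski open dense set of points, contained in `U`, on which the initial ideal is
constant.  The ideals corresponding to its points are the `V`-generic ideals. -/
structure IsVGenericSet {k : Type*} [Field k] {n s : ℕ} (m : MonomialOrder (Fin n))
    (d : Fin s → ℕ) (V : Set (Param n d → k)) : Prop where
  isOpen : IsZariskiOpen V
  dense : IsZariskiDense V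
  subset : V ⊆ uGenericSet k n d
  const : ∀ a ∈ V, ∀ b ∈ V, initialIdeal m (idealAt d a) = initialIdeal m (idealAt d b)

end GenericForms

end

/-! Let `q` be the product of the leading coefficients in `k[t]` of the nonzero `g ∈ G`, viewed in
`k[t][x]`. Where `q` does not vanish, `G` specializes well (`initialIdeal_map_specialize`). Lift `f
∈ I_a` to some `F` in the generic ideal. The inverse block order makes the x-leading monomial of
some `g` divide that of `F`. If the leading coefficient of `F` survives at `a`, this monomial is
that of `f`. If it vanishes, cross-multiplying `F` and `g` cancels the top term and changes `f` only
by the nonzero scalar given by the leading coefficient of `g` at `a`; well-foundedness of the order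
ends the process.

As `k` is infinite, the locus `q ≠ 0` is dense. It lies in `U`: Hilbert functions are determined by
initial ideals, hence constant there, and by semicontinuity (`exists_eval_ne_zero_imp_finrank_le`)
each `b` has an open neighbourhood, meeting this locus, on which the degree `e` part of the ideal is
no smaller than at `b`. Any other V-generic set is dense, so it meets the locus, and its constant
initial ideal is the one found there. -/

namespace GenericForms

attribute [local instance] MvPolynomial.gradedAlgebra

/-! ### Initial ideals as monomial ideals. -/

section InitialIdeal

variable {σ k : Type*} [Field k] {m : MonomialOrder σ}

theorem initialIdeal_eq_span_monomial (I : Ideal (MvPolynomial σ k)) :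
    initialIdeal m I = Ideal.span ((fun v ↦ monomial v (1 : k)) ''
      (m.degree '' ((I : Set (MvPolynomial σ k)) \ {0}))) := by
  rw [Set.image_image, ← MonomialOrder.span_leadingTerm_eq_span_monomial', initialIdeal]
  congr 1
  ext p
  simp [eq_comm]

/-- Leading exponents of an ideal are closed under adding any exponent: multiply the polynomial by a
monomial. -/
theorem monomial_mem_initialIdeal_iff {I : Ideal (MvPolynomial σ k)} {v : σ →₀ ℕ} :
    monomial v (1 : k) ∈ initialIdeal m I ↔ ∃ f ∈ I, f ≠ 0 ∧ m.degree f = v := by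
  classical
  rw [initialIdeal_eq_span_monomial, mem_ideal_span_monomial_image]
  simp only [support_monomial, one_ne_zero, if_false, Finset.mem_singleton, forall_eq]
  constructor
  · rintro ⟨_, ⟨f, ⟨hf, hf0⟩, rfl⟩, hle⟩
    have hm : monomial (v - m.degree f) (1 : k) ≠ 0 := by simp
    refine ⟨monomial (v - m.degree f) 1 * f, I.mul_mem_left _ hf, mul_ne_zero hm hf0, ?_⟩
    rw [m.degree_mul hm hf0, m.degree_monomial, if_neg one_ne_zero, tsub_add_cancel_of_le hle]
  · rintro ⟨f, hf, hf0, rfl⟩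
    exact ⟨_, ⟨f, ⟨hf, hf0⟩, rfl⟩, le_rfl⟩

theorem IsGroebnerBasis.exists_degree_le {G : Finset (MvPolynomial σ k)}
    {I : Ideal (MvPolynomial σ k)} (hG : IsGroebnerBasis m G I) {f : MvPolynomial σ k}
    (hf : f ∈ I) (hf0 : f ≠ 0) : ∃ g ∈ G, g ≠ 0 ∧ m.degree g ≤ m.degree f := by
  classical
  have hmem : monomial (m.degree f) (1 : k) ∈ initialIdeal m I :=
    monomial_mem_initialIdeal_iff.2 ⟨f, hf, hf0, rfl⟩
  have hspan : Ideal.span {p | ∃ g ∈ G, p = m.leadingTerm g} =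
      Ideal.span ((fun v ↦ monomial v (1 : k)) ''
        (m.degree '' ((G : Set (MvPolynomial σ k)) \ {0}))) := by
    rw [Set.image_image, ← MonomialOrder.span_leadingTerm_eq_span_monomial']
    congr 1
    ext p
    simp [eq_comm]
  rw [hG.2, hspan, mem_ideal_span_monomial_image] at hmem
  obtain ⟨_, ⟨g, ⟨hg, hg0⟩, rfl⟩, hle⟩ := hmem (m.degree f) (by simp [support_monomial])
  exact ⟨g, hg, hg0, hle⟩

end InitialIdeal

/-! ### Hilbert functions and initial ideals. -/

section GradedPart

variable {σ k : Type*} [Field k]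

/-- The forms of degree `e` in `I`. -/
noncomputable def gradedPart (I : Ideal (MvPolynomial σ k)) (e : ℕ) :
    Submodule k (MvPolynomial σ k) :=
  I.restrictScalars k ⊓ homogeneousSubmodule σ k e

theorem mem_gradedPart {I : Ideal (MvPolynomial σ k)} {e : ℕ} {f : MvPolynomial σ k} :
    f ∈ gradedPart I e ↔ f ∈ I ∧ f.IsHomogeneous e := Iff.rfl

instance finiteDimensional_homogeneousSubmodule [Finite σ] (e : ℕ) :
    FiniteDimensional k (homogeneousSubmodule σ k e) :=
  Module.Finite.iff_fg.2 (homogeneousSubmodule_fg σ k e)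

instance finiteDimensional_gradedPart [Finite σ] (I : Ideal (MvPolynomial σ k)) (e : ℕ) :
    FiniteDimensional k (gradedPart I e) :=
  Submodule.finiteDimensional_of_le (inf_le_right : gradedPart I e ≤ homogeneousSubmodule σ k e)

/-- Rank-nullity for the quotient map restricted to forms of degree `e`. A smaller Hilbert function
thus means a larger graded part. -/
theorem hilbertFunction_add_finrank_gradedPart {n : ℕ} (I : Ideal (MvPolynomial (Fin n) k))
    (e : ℕ) : hilbertFunction I e + Module.finrank k (gradedPart I e) =
      Module.finrank k (homogeneousSubmodule (Fin n) k e) := by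
  have h := ((Ideal.Quotient.mkₐ k I).toLinearMap.domRestrict
    (homogeneousSubmodule (Fin n) k e)).finrank_range_add_finrank_ker
  rw [LinearMap.range_domRestrict, ← Submodule.finrank_map_subtype_eq] at h
  have hS : gradedPart I e = Submodule.map (homogeneousSubmodule (Fin n) k e).subtype
      ((Ideal.Quotient.mkₐ k I).toLinearMap.domRestrict
        (homogeneousSubmodule (Fin n) k e)).ker := by
    ext f
    simp [mem_gradedPart, Ideal.Quotient.eq_zero_iff_mem, and_comm]
  rw [← h, hilbertFunction, hS]

variable {m : MonomialOrder σ}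

/-- The dimension of a space of polynomials is the number of its leading exponents. -/
theorem finrank_eq_ncard_degree (L : Submodule k (MvPolynomial σ k)) [FiniteDimensional k L]
    (hfin : (m.degree '' ((L : Set (MvPolynomial σ k)) \ {0})).Finite) :
    Module.finrank k L = (m.degree '' ((L : Set (MvPolynomial σ k)) \ {0})).ncard := by
  classical
  set S := m.degree '' ((L : Set (MvPolynomial σ k)) \ {0}) with hS
  have : Fintype S := hfin.fintype
  rw [← Nat.card_coe_set_eq, Nat.card_eq_fintype_card]
  apply le_antisymm
  -- An element of `L` whose coefficients vanish at all leading exponents of `L` has zero leading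
  -- coefficient, so is zero.
  · let φ : L →ₗ[k] (S → k) := (LinearMap.pi fun v : S ↦ lcoeff k v.1).comp L.subtype
    have hφ : Function.Injective φ := by
      rw [← LinearMap.ker_eq_bot, LinearMap.ker_eq_bot']
      rintro ⟨f, hf⟩ h0
      by_contra hne
      have hf0 : f ≠ 0 := fun h ↦ hne (by simp [h])
      have := congrFun h0 ⟨m.degree f, f, ⟨hf, hf0⟩, rfl⟩
      exact m.coeff_degree_ne_zero_iff.2 hf0 this
    simpa using LinearMap.finrank_le_finrank_of_injective hφ
  · have hch : ∀ v : S, ∃ f : L, (f : MvPolynomial σ k) ≠ 0 ∧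
        m.degree (f : MvPolynomial σ k) = v := by
      rintro ⟨_, f, ⟨hf, hf0⟩, rfl⟩
      exact ⟨⟨f, hf⟩, hf0, rfl⟩
    choose f hf0 hf using hch
    suffices LinearIndependent k f from this.fintype_card_le_finrank
    rw [linearIndependent_iff']
    intro s c hc
    by_contra! hcon
    obtain ⟨i, his, hi⟩ := hcon
    -- At the largest leading exponent occurring in the relation, only `f j` has a nonzero
    -- coefficient.
    obtain ⟨j, hj, hmax⟩ := (s.filter fun i ↦ c i ≠ 0).exists_max_image
      (fun i ↦ m.toSyn i.1) ⟨i, by simp [his, hi]⟩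
    rw [Finset.mem_filter] at hj
    have h0 : ∑ i ∈ s, c i * coeff j.1 (f i : MvPolynomial σ k) = 0 := by
      have := congrArg (fun x : L ↦ coeff j.1 (x : MvPolynomial σ k)) hc
      simpa [coeff_sum] using this
    rw [Finset.sum_eq_single j] at h0
    · refine mul_ne_zero hj.2 ?_ h0
      rw [← hf j]
      exact m.coeff_degree_ne_zero_iff.2 (hf0 j)
    · intro i hi hij
      by_cases hci : c i = 0
      · simp [hci]
      · rw [m.coeff_eq_zero_of_lt, mul_zero]
        rw [hf i]
        exact lt_of_le_of_ne (hmax i (by simp [hi, hci]))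
          fun h ↦ hij (Subtype.ext (m.toSyn.injective h))
    · exact fun h ↦ absurd hj.1 h

/-- Homogeneity lets `f ∈ I` be replaced by its component in the degree of its leading monomial,
which stays in `I` and keeps that monomial. -/
theorem degree_image_gradedPart {I : Ideal (MvPolynomial σ k)}
    (hI : I.IsHomogeneous (homogeneousSubmodule σ k)) (e : ℕ) :
    m.degree '' ((gradedPart I e : Set (MvPolynomial σ k)) \ {0}) =
      {v | v.degree = e ∧ monomial v (1 : k) ∈ initialIdeal m I} := by
  ext v
  simp only [Set.mem_ofPred_eq, monomial_mem_initialIdeal_iff]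
  constructor
  · rintro ⟨f, ⟨hf, hf0⟩, rfl⟩
    refine ⟨?_, f, hf.1, hf0, rfl⟩
    by_contra hne
    exact m.coeff_degree_ne_zero_iff.2 hf0 ((mem_gradedPart.1 hf).2.coeff_eq_zero hne)
  · rintro ⟨rfl, f, hf, hf0, rfl⟩
    have hc : coeff (m.degree f) (homogeneousComponent (m.degree f).degree f) ≠ 0 := by
      rw [coeff_homogeneousComponent, if_pos rfl]
      exact m.coeff_degree_ne_zero_iff.2 hf0
    refine ⟨homogeneousComponent (m.degree f).degree f,
      ⟨⟨homogeneousComponent_mem_of_mem hI hf _, homogeneousComponent_mem _ _⟩, ?_⟩, ?_⟩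
    · rintro h
      rw [Set.mem_singleton_iff] at h
      simp [h] at hc
    · apply m.toSyn.injective
      refine le_antisymm ?_ (m.le_degree (mem_support_iff.2 hc))
      apply m.degree_le_degree_of_support_subset
      rw [support_homogeneousComponent]
      exact Finset.filter_subset _ _

theorem finite_degree_eq [Finite σ] (e : ℕ) : {v : σ →₀ ℕ | v.degree = e}.Finite := by
  classical
  have := Fintype.ofFinite σ
  refine (Finset.finite_toSet (Finset.finsuppAntidiag (Finset.univ : Finset σ) e)).subset ?_
  intro v hv
  simpa [Finsupp.degree_eq_sum] using hv

/-- The Hilbert function of a homogeneous ideal depends only on its initial ideal. -/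
theorem finrank_gradedPart_eq_of_initialIdeal_eq [Finite σ] {I J : Ideal (MvPolynomial σ k)}
    (hI : I.IsHomogeneous (homogeneousSubmodule σ k))
    (hJ : J.IsHomogeneous (homogeneousSubmodule σ k))
    (h : initialIdeal m I = initialIdeal m J) (e : ℕ) :
    Module.finrank k (gradedPart I e) = Module.finrank k (gradedPart J e) := by
  rw [finrank_eq_ncard_degree (m := m), finrank_eq_ncard_degree (m := m),
    degree_image_gradedPart hI, degree_image_gradedPart hJ, h]
  · rw [degree_image_gradedPart hJ]
    exact (finite_degree_eq e).subset fun v hv ↦ hv.1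
  · rw [degree_image_gradedPart hI]
    exact (finite_degree_eq e).subset fun v hv ↦ hv.1

end GradedPart

/-! ### Specialization of the parameters and semicontinuity. -/

section Specialize

variable {σ τ k : Type*} [Field k]

theorem coeff_coeff_sumAlgEquiv (F : MvPolynomial (σ ⊕ τ) k) (v : σ →₀ ℕ) (u : τ →₀ ℕ) :
    coeff u (coeff v (sumAlgEquiv k σ τ F)) = coeff (Finsupp.sumElim v u) F := by
  simp [sumAlgEquiv, coeff, AddMonoidAlgebra.curryAlgEquiv, AddMonoidAlgebra.curryRingEquiv,
    AddMonoidAlgebra.curryAddEquiv]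

theorem specialize_eq_map (a : τ → k) (F : MvPolynomial (σ ⊕ τ) k) :
    specialize a F = map (eval a) (sumAlgEquiv k σ τ F) := by
  have : specialize a = ((mapAlgHom (aeval a)).comp (sumAlgEquiv k σ τ).toAlgHom :
      MvPolynomial (σ ⊕ τ) k →ₐ[k] MvPolynomial σ k) := by
    ext i : 1
    rcases i with i | i <;> simp [specialize]
  rw [this]
  simp [coe_aeval_eq_eval]

theorem coeff_specialize (a : τ → k) (F : MvPolynomial (σ ⊕ τ) k) (v : σ →₀ ℕ) :
    coeff v (specialize a F) = eval a (coeff v (sumAlgEquiv k σ τ F)) := by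
  rw [specialize_eq_map, coeff_map]

theorem specialize_rename_inl (a : τ → k) (f : MvPolynomial σ k) :
    specialize a (rename Sum.inl f) = f := by
  rw [specialize, aeval_rename, Sum.elim_comp_inl, aeval_X_left, AlgHom.id_apply]

theorem mem_map_specialize_iff {a : τ → k} {I : Ideal (MvPolynomial (σ ⊕ τ) k)}
    {f : MvPolynomial σ k} :
    f ∈ I.map (specialize a) ↔ ∃ F ∈ I, specialize a F = f :=
  Ideal.mem_map_iff_of_surjective (specialize a : MvPolynomial (σ ⊕ τ) k →ₐ[k] MvPolynomial σ k)
    fun f ↦ ⟨_, specialize_rename_inl a f⟩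

/-- Lower semicontinuity of the dimension of the degree `e` part. -/
theorem exists_eval_ne_zero_imp_finrank_le [Finite σ] (I : Ideal (MvPolynomial (σ ⊕ τ) k))
    (hI : ∀ a : τ → k, (I.map (specialize a)).IsHomogeneous (homogeneousSubmodule σ k))
    (b : τ → k) (e : ℕ) :
    ∃ q : MvPolynomial τ k, eval b q ≠ 0 ∧ ∀ a, eval a q ≠ 0 →
      Module.finrank k (gradedPart (I.map (specialize b)) e) ≤
        Module.finrank k (gradedPart (I.map (specialize a)) e) := by
  classical
  set B := Module.finBasis k (gradedPart (I.map (specialize b)) e)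
  set r := Module.finrank k (gradedPart (I.map (specialize b)) e)
  have hB : LinearIndependent k fun i ↦ (B i : MvPolynomial σ k) :=
    B.linearIndependent.map' (Submodule.subtype _) (Submodule.ker_subtype _)
  choose F hFI hF using fun i ↦ mem_map_specialize_iff.1 (mem_gradedPart.1 (B i).2).1
  -- `φ` extends the coordinates with respect to `B` to all polynomials, so it can be applied at
  -- every point `a`.
  obtain ⟨φ, hφ⟩ := (Fintype.linearCombination k fun i ↦ (B i : MvPolynomial σ k)
    ).exists_leftInverse_of_injective 
      (LinearMap.ker_eq_bot.2 hB.fintypeLinearCombination_injective)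
  have hφB (j : Fin r) : φ (B j) = Pi.single j 1 := by
    have := LinearMap.congr_fun hφ (Pi.single j 1)
    simpa using this
  -- The lifts `F j` need not be homogeneous in `x`, so the degree `e` component is taken first.
  set ψ : MvPolynomial σ k →ₗ[k] (Fin r → k) := φ ∘ₗ homogeneousComponent e
  -- Row `j` holds the values of `ψ` on `F j`, with entries polynomial in `t`. At `b` it is the
  -- identity; where its determinant is nonzero, the degree `e` components of the specialized lifts
  -- are independent.
  let M : Matrix (Fin r) (Fin r) (MvPolynomial τ k) := .of fun j i ↦
    ∑ v ∈ (sumAlgEquiv k σ τ (F j)).support,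
      coeff v (sumAlgEquiv k σ τ (F j)) * C (ψ (monomial v 1) i)
  have hM (a : τ → k) : (eval a).mapMatrix M = .of fun j ↦ ψ (specialize a (F j)) := by
    ext j i
    rw [Matrix.of_apply, specialize_eq_map]
    conv_rhs => rw [(sumAlgEquiv k σ τ (F j)).as_sum]
    have hmon (v : σ →₀ ℕ) (c : k) : monomial v c = c • monomial v 1 := by
      rw [smul_monomial, smul_eq_mul, mul_one]
    simp only [Matrix.of_apply, map_sum, map_monomial, RingHom.mapMatrix_apply, Matrix.map_apply, M]
    rw [Finset.sum_apply]
    refine Finset.sum_congr rfl fun v _ ↦ ?_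
    rw [hmon v (eval a _), map_smul, map_mul, eval_C, Pi.smul_apply, smul_eq_mul]
  refine ⟨M.det, ?_, fun a ha ↦ ?_⟩
  · rw [RingHom.map_det, hM]
    have : (Matrix.of fun j ↦ ψ (specialize b (F j))) = (1 : Matrix (Fin r) (Fin r) k) := by
      ext j i
      simp [ψ, hF, homogeneousComponent_eq_self (mem_gradedPart.1 (B j).2).2, hφB,
        Matrix.one_apply, Pi.single_apply, eq_comm]
    simp [this]
  · rw [RingHom.map_det, hM] at ha
    have hrows := Matrix.linearIndependent_rows_of_det_ne_zero ha
    have hind : LinearIndependent k fun j ↦ (⟨homogeneousComponent e (specialize a (F j)),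
        homogeneousComponent_mem_of_mem (hI a) (mem_map_specialize_iff.2 ⟨_, hFI j, rfl⟩) e,
        homogeneousComponent_mem _ _⟩ : gradedPart (I.map (specialize a)) e) :=
      LinearIndependent.of_comp (φ ∘ₗ Submodule.subtype _) hrows
    simpa using hind.fintype_card_le_finrank

end Specialize

/-! ### Gröbner bases for an inverse block order under specialization. -/

section BlockOrder

variable {σ τ k : Type*} [Field k] {mx : MonomialOrder σ} {mt : MonomialOrder τ}
  {m' : MonomialOrder (σ ⊕ τ)}

theorem sumAlgEquiv_ne_zero {F : MvPolynomial (σ ⊕ τ) k} (hF : F ≠ 0) :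
    sumAlgEquiv k σ τ F ≠ 0 :=
  (map_ne_zero_iff _ (sumAlgEquiv k σ τ).injective).2 hF

/-- Since x-parts are compared first, the x-part of the `m'`-leading exponent is maximal for `mx`
among the x-exponents of `F`. -/
theorem IsInverseBlock.degree_inl (h : IsInverseBlock mx mt m') {F : MvPolynomial (σ ⊕ τ) k}
    (hF : F ≠ 0) (j : σ) : m'.degree F (Sum.inl j) = xLeadingExponent mx F j := by
  obtain ⟨⟨v, u⟩, hvu⟩ := Finsupp.sumFinsuppEquivProdFinsupp.symm.surjective (m'.degree F)
  replace hvu : Finsupp.sumElim v u = m'.degree F := hvu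
  suffices hv : v = xLeadingExponent mx F by
    rw [← hvu, Finsupp.sumElim_inl, hv]
  have hsupp : v ∈ (sumAlgEquiv k σ τ F).support := by
    rw [mem_support_iff]
    intro h0
    have := coeff_coeff_sumAlgEquiv F v u
    rw [h0, hvu, coeff_zero] at this
    exact m'.coeff_degree_ne_zero_iff.2 hF this.symm
  apply mx.toSyn.injective
  refine le_antisymm (mx.le_degree hsupp) ?_
  have hne := mx.coeff_degree_ne_zero_iff.2 (sumAlgEquiv_ne_zero hF)
  obtain ⟨u', hu'⟩ := exists_coeff_ne_zero hne
  rw [coeff_coeff_sumAlgEquiv] at hu'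
  have hle := m'.le_degree (mem_support_iff.2 hu')
  rw [← hvu, h] at hle
  rcases hle with hlt | ⟨heq, -⟩
  · exact hlt.le
  · exact (congrArg mx.toSyn heq).le

theorem IsInverseBlock.xLeadingExponent_le (h : IsInverseBlock mx mt m')
    {F g : MvPolynomial (σ ⊕ τ) k} (hF : F ≠ 0) (hg : g ≠ 0) (hle : m'.degree g ≤ m'.degree F) :
    xLeadingExponent mx g ≤ xLeadingExponent mx F := fun j ↦ by
  rw [← h.degree_inl hF, ← h.degree_inl hg]
  exact hle _

variable (mx) in
/-- The leading coefficient in `k[t]` of `g` viewed as an element of `k[t][x]`. -/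
noncomputable def xLeadingCoeff (g : MvPolynomial (σ ⊕ τ) k) : MvPolynomial τ k :=
  mx.leadingCoeff (sumAlgEquiv k σ τ g)

theorem xLeadingCoeff_ne_zero {g : MvPolynomial (σ ⊕ τ) k} (hg : g ≠ 0) :
    xLeadingCoeff mx g ≠ 0 :=
  mx.leadingCoeff_ne_zero_iff.2 (sumAlgEquiv_ne_zero hg)

theorem coeff_xLeadingExponent_specialize (a : τ → k) (F : MvPolynomial (σ ⊕ τ) k) :
    coeff (xLeadingExponent mx F) (specialize a F) = eval a (xLeadingCoeff mx F) :=
  coeff_specialize a F _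

theorem degree_specialize_le (a : τ → k) (F : MvPolynomial (σ ⊕ τ) k) :
    mx.toSyn (mx.degree (specialize a F)) ≤ mx.toSyn (xLeadingExponent mx F) := by
  rw [specialize_eq_map, mx.degree_le_iff]
  exact fun v hv ↦ mx.le_degree (support_map_subset _ _ hv)

theorem degree_specialize_eq {a : τ → k} {F : MvPolynomial (σ ⊕ τ) k}
    (h : eval a (xLeadingCoeff mx F) ≠ 0) :
    mx.degree (specialize a F) = xLeadingExponent mx F := by
  apply mx.toSyn.injective
  refine (degree_specialize_le a F).antisymm (mx.le_degree (mem_support_iff.2 ?_))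
  rwa [coeff_xLeadingExponent_specialize]

/-- One step of pseudo-reduction: it lowers the `x`-degree without changing the specialization at a
point where the leading coefficient of `F` vanishes, up to a scalar. -/
theorem exists_reduction {F g : MvPolynomial (σ ⊕ τ) k} {I : Ideal (MvPolynomial (σ ⊕ τ) k)}
    (hFI : F ∈ I) (hgI : g ∈ I) (hle : xLeadingExponent mx g ≤ xLeadingExponent mx F) {a : τ → k}
    (ha : eval a (xLeadingCoeff mx F) = 0) (hga : eval a (xLeadingCoeff mx g) ≠ 0)
    (hF : specialize a F ≠ 0) :
    ∃ F' ∈ I, specialize a F' = C (eval a (xLeadingCoeff mx g)) * specialize a F ∧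
      mx.toSyn (xLeadingExponent mx F') < mx.toSyn (xLeadingExponent mx F) := by
  classical
  set P := sumAlgEquiv k σ τ F with hP
  set Q := sumAlgEquiv k σ τ g with hQ
  set R := C (mx.leadingCoeff Q) * P - monomial (mx.degree P - mx.degree Q) (mx.leadingCoeff P) * Q
    with hR
  have hmap : map (eval a) R = C (eval a (xLeadingCoeff mx g)) * specialize a F := by
    have ha' : eval a (mx.leadingCoeff P) = 0 := ha
    simp [hR, specialize_eq_map, ← hP, ha', xLeadingCoeff, ← hQ]
  -- Needed for the strict inequality: the degree of `0` is `0`, which would not be a drop if `F`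
  -- already had x-degree `0`.
  have hR0 : R ≠ 0 := by
    rintro h
    rw [h, map_zero, eq_comm, mul_eq_zero, C_eq_zero] at hmap
    exact hmap.elim hga hF
  refine ⟨(sumAlgEquiv k σ τ).symm R, ?_, ?_, ?_⟩
  · rw [hR, map_sub, map_mul, map_mul, hP, hQ, AlgEquiv.symm_apply_apply, AlgEquiv.symm_apply_apply]
    exact I.sub_mem (I.mul_mem_left _ hFI) (I.mul_mem_left _ hgI)
  · rw [specialize_eq_map, AlgEquiv.apply_symm_apply, hmap]
  · simp only [xLeadingExponent, AlgEquiv.apply_symm_apply]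
    replace hle : mx.degree Q ≤ mx.degree P := hle
    refine lt_of_le_of_ne ?_ fun heq ↦ ?_
    · refine mx.degree_sub_le.trans (sup_le ?_ ?_)
      · refine mx.degree_mul_le.trans ?_
        rw [mx.degree_C, zero_add]
      · refine mx.degree_mul_le.trans ?_
        refine (mx.toSyn.map_add _ _).trans_le ?_
        refine (add_le_add_left (mx.degree_monomial_le _) _).trans ?_
        rw [← map_add, tsub_add_cancel_of_le hle]
    · apply mx.coeff_degree_ne_zero_iff.2 hR0
      have hcoeff : coeff (mx.degree P)
          (monomial (mx.degree P - mx.degree Q) (mx.leadingCoeff P) * Q) =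
            mx.leadingCoeff P * mx.leadingCoeff Q := by
        conv_lhs => rw [← tsub_add_cancel_of_le hle, add_tsub_cancel_right]
        rw [coeff_monomial_mul]
        rfl
      rw [mx.toSyn.injective heq, ← hP, hR, coeff_sub, coeff_C_mul, hcoeff, mul_comm]
      exact sub_self _

/-- A Gröbner basis for an inverse block order specializes well at the points where no leading
coefficient of a nonzero element vanishes. -/
theorem initialIdeal_map_specialize (h : IsInverseBlock mx mt m')
    {G : Finset (MvPolynomial (σ ⊕ τ) k)} {I : Ideal (MvPolynomial (σ ⊕ τ) k)}
    (hG : IsGroebnerBasis m' G I) {a : τ → k}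
    (ha : ∀ g ∈ G, g ≠ 0 → eval a (xLeadingCoeff mx g) ≠ 0) :
    initialIdeal mx (I.map (specialize a)) = xLeadingIdeal mx G := by
  apply le_antisymm
  · rw [initialIdeal_eq_span_monomial, Ideal.span_le]
    rintro _ ⟨_, ⟨f, ⟨hf, hf0⟩, rfl⟩, rfl⟩
    obtain ⟨F, hFI, hFf⟩ := mem_map_specialize_iff.1 hf
    -- The induction is on the x-degree of the lift `F`; the leading exponent of its specialization
    -- stays fixed throughout.
    have key : ∀ (y : mx.syn) (F : MvPolynomial (σ ⊕ τ) k), mx.toSyn (xLeadingExponent mx F) = y →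
        F ∈ I → specialize a F ≠ 0 →
          ∃ g ∈ G, g ≠ 0 ∧ xLeadingExponent mx g ≤ mx.degree (specialize a F) := by
      intro y
      induction y using WellFoundedLT.induction with
      | ind y ih =>
      rintro F rfl hFI hF0
      have hF : F ≠ 0 := fun h ↦ hF0 (by rw [h, map_zero])
      obtain ⟨g, hg, hg0, hle⟩ := hG.exists_degree_le hFI hF
      replace hle := h.xLeadingExponent_le hF hg0 hle
      by_cases hc : eval a (xLeadingCoeff mx F) = 0
      · obtain ⟨F', hF'I, hF', hlt⟩ := exists_reduction hFI (hG.1 g hg) hle hc (ha g hg hg0) hF0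
        have hC : (C (eval a (xLeadingCoeff mx g)) : MvPolynomial σ k) ≠ 0 :=
          C_ne_zero.2 (ha g hg hg0)
        have := ih _ hlt F' rfl hF'I (hF' ▸ mul_ne_zero hC hF0)
        rwa [hF', mx.degree_mul hC hF0, mx.degree_C, zero_add] at this
      · exact ⟨g, hg, hg0, (degree_specialize_eq hc).symm ▸ hle⟩
    obtain ⟨g, hg, hg0, hle⟩ := key _ F rfl hFI (hFf ▸ hf0)
    rw [hFf] at hle
    have hmon : monomial (mx.degree f) (1 : k) =
        monomial (mx.degree f - xLeadingExponent mx g) 1 * monomial (xLeadingExponent mx g) 1 := by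
      rw [monomial_mul, one_mul, tsub_add_cancel_of_le hle]
    simp only [hmon]
    exact Ideal.mul_mem_left _ _ (Ideal.subset_span ⟨g, hg, hg0, rfl⟩)
  · rw [xLeadingIdeal, Ideal.span_le]
    rintro _ ⟨g, hg, hg0, rfl⟩
    refine monomial_mem_initialIdeal_iff.2
      ⟨specialize a g, Ideal.mem_map_of_mem _ (hG.1 g hg), ?_, degree_specialize_eq (ha g hg hg0)⟩
    intro h0
    apply ha g hg hg0
    rw [← coeff_xLeadingExponent_specialize, h0, coeff_zero]

end BlockOrder

/-! ### Nonvanishing loci over an infinite field. -/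

section Zariski

variable {τ k : Type*} [Field k]

theorem isZariskiOpen_eval_ne_zero (q : MvPolynomial τ k) : IsZariskiOpen {a | eval a q ≠ 0} := by
  refine ⟨Ideal.span {q}, ?_⟩
  ext a
  simp only [Set.mem_ofPred_eq, Set.mem_compl_iff, not_iff_not, mem_zeroLocus_iff]
  constructor
  · intro h p hp
    obtain ⟨r, rfl⟩ := Ideal.mem_span_singleton'.1 hp
    simp [h]
  · intro h
    simpa [coe_aeval_eq_eval] using h q (Ideal.mem_span_singleton_self q)

theorem exists_eval_ne_zero [Infinite k] {q : MvPolynomial τ k} (hq : q ≠ 0) :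
    ∃ a, eval a q ≠ 0 := by
  by_contra! h
  exact hq (MvPolynomial.funext fun a ↦ by rw [h a, map_zero])

theorem isZariskiDense_eval_ne_zero [Infinite k] {q : MvPolynomial τ k} (hq : q ≠ 0) :
    IsZariskiDense {a | eval a q ≠ 0} := by
  rintro _ ⟨P, rfl⟩ ⟨b, hb⟩
  simp only [Set.mem_compl_iff, mem_zeroLocus_iff, not_forall] at hb
  obtain ⟨p, hp, hpb⟩ := hb
  have hp0 : p ≠ 0 := fun h ↦ hpb (by rw [h, map_zero])
  obtain ⟨a, ha⟩ := exists_eval_ne_zero (mul_ne_zero hq hp0)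
  rw [map_mul, mul_ne_zero_iff] at ha
  exact ⟨a, ha.1, fun h ↦ ha.2 (by simpa [coe_aeval_eq_eval] using h p hp)⟩

end Zariski

/-! ### Homogeneity of the specialized generic ideals. -/

section GenericIdeal

variable {k : Type*} [Field k] {n s : ℕ} (d : Fin s → ℕ)

theorem idealAt_eq_map (a : Param n d → k) :
    idealAt d a = (genericIdeal k n d).map (specialize a) := by
  rw [genericIdeal, Ideal.map_span, ← Set.range_comp, idealAt]
  rfl

theorem isHomogeneous_specialize_genericForm (a : Param n d → k) (i : Fin s) :
    (specialize a (genericForm k n d i)).IsHomogeneous (d i) := by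
  simp only [genericForm, map_sum, map_mul, map_prod, map_pow]
  refine IsHomogeneous.sum _ _ _ fun e _ ↦ ?_
  simp only [specialize, aeval_X, Sum.elim_inl, Sum.elim_inr]
  refine IsHomogeneous.C_mul ?_ _
  have he := (Finset.mem_finsuppAntidiag.1 e.2).1
  have hprod := IsHomogeneous.prod Finset.univ
    (fun j ↦ (X j : MvPolynomial (Fin n) k) ^ (e : Fin n →₀ ℕ) j) _
    fun j _ ↦ isHomogeneous_X_pow j _
  rwa [he] at hprod

theorem isHomogeneous_idealAt (a : Param n d → k) :
    (idealAt d a).IsHomogeneous (homogeneousSubmodule (Fin n) k) := by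
  apply Ideal.homogeneous_span
  rintro _ ⟨i, rfl⟩
  exact ⟨d i, isHomogeneous_specialize_genericForm d a i⟩

end GenericIdeal

end GenericForms

theorem theorem3p10 {k : Type*} [Field k] [Infinite k] (n s : ℕ) (d : Fin s → ℕ)
    (mx : MonomialOrder (Fin n)) (mt : MonomialOrder (GenericForms.Param n d))
    (m' : MonomialOrder (Fin n ⊕ GenericForms.Param n d))
    (hm' : GenericForms.IsInverseBlock mx mt m')
    (G : Finset (MvPolynomial (Fin n ⊕ GenericForms.Param n d) k))
    (hG : GenericForms.IsGroebnerBasis m' G (GenericForms.genericIdeal k n d)) :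
    (∃ V : Set (GenericForms.Param n d → k), GenericForms.IsVGenericSet mx d V) ∧
      ∀ V : Set (GenericForms.Param n d → k), GenericForms.IsVGenericSet mx d V →
        ∀ a ∈ V, GenericForms.initialIdeal mx (GenericForms.idealAt d a) =
          GenericForms.xLeadingIdeal mx G := by
  classical
  open GenericForms in
  set q : MvPolynomial (Param n d) k := ∏ g ∈ G with g ≠ 0, xLeadingCoeff mx g with hq
  have hq0 : q ≠ 0 := Finset.prod_ne_zero_iff.2 fun g hg ↦
    xLeadingCoeff_ne_zero (Finset.mem_filter.1 hg).2
  have hin (a : Param n d → k) (ha : eval a q ≠ 0) :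
      initialIdeal mx (idealAt d a) = xLeadingIdeal mx G := by
    rw [idealAt_eq_map]
    refine initialIdeal_map_specialize hm' hG fun g hg hg0 ↦ ?_
    rw [hq, map_prod, Finset.prod_ne_zero_iff] at ha
    exact ha g (Finset.mem_filter.2 ⟨hg, hg0⟩)
  have hopen := isZariskiOpen_eval_ne_zero q
  refine ⟨⟨{a | eval a q ≠ 0}, hopen, isZariskiDense_eval_ne_zero hq0, fun a ha b e ↦ ?_,
    fun a ha b hb ↦ (hin a ha).trans (hin b hb).symm⟩, fun V hV a ha ↦ ?_⟩
  · obtain ⟨p, hpb, hp⟩ := exists_eval_ne_zero_imp_finrank_le (genericIdeal k n d)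
      (fun a ↦ idealAt_eq_map d a ▸ isHomogeneous_idealAt d a) b e
    -- The point `c` links `b` to `a`: semicontinuity compares `b` with `c`, while `c` and `a` share
    -- their initial ideal.
    obtain ⟨c, hqc, hpc⟩ := isZariskiDense_eval_ne_zero hq0 _
      (isZariskiOpen_eval_ne_zero p) ⟨b, hpb⟩
    have hle := hp c hpc
    rw [← idealAt_eq_map, ← idealAt_eq_map, ← finrank_gradedPart_eq_of_initialIdeal_eq
      (isHomogeneous_idealAt d a) (isHomogeneous_idealAt d c)
      ((hin a ha).trans (hin c hqc).symm)] at hle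
    have h1 := hilbertFunction_add_finrank_gradedPart (idealAt d a) e
    have h2 := hilbertFunction_add_finrank_gradedPart (idealAt d b) e
    omega
  · obtain ⟨c, hcV, hcq⟩ := hV.dense _ hopen (exists_eval_ne_zero hq0)
    exact (hV.const a ha c hcV).trans (hin c hcq)
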